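/- Let $R$ be an associative ring with $1$, not necessarily commutative, and let $M$ be a (unital) right $R$-module. For a regular uncountable cardinal $\kappa$, a *$\kappa$-dense system* in $M$ is a directed family $\mathcal C$ of submodules of $M$ that is closed under unions of (nonempty) well-ordered ascending chains of length $<\kappa$ and such that every subset of $M$ of cardinality $<\kappa$ is contained in an element of $\mathcal C$. The module $M$ is *$\kappa$-projective* if it has a $\kappa$-dense system consisting of projective submodules each of which has a generating set of cardinality $<\kappa$. The module $M$ is *Mittag--Leffler* if for each family $(Q_i)_{i\in I}$ of left $R$-modules the canonical map $M\otimes_R\prod_{i\in I}Q_i\to\prod_{i\in I}(M\otimes_R Q_i)$ is injective. Then: (i) $M$ is $\aleph_1$-projective if and only if $M$ is a flat Mittag--Leffler module. (ii) If $\kappa$ is a regular uncountable cardinal and $M$ is $\kappa$-projective, then $M$ is a flat Mittag--Leffler module. -/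

import Mathlib

open scoped TensorProduct

/-!
Right `R`-modules are modules over `Rᵐᵒᵖ`, so `m r` is written `MulOpposite.op r • m`;
left `R`-modules are modules over `R`.
-/

universe u v w w'

namespace MLModule

section Tensor

variable (R : Type u) [Ring R] (M : Type v) [AddCommGroup M] [Module Rᵐᵒᵖ M]

/-- The subgroup of `M ⊗_ℤ Q` generated by all `m r ⊗ q - m ⊗ r q`. -/
def balancedRel (Q : Type w) [AddCommGroup Q] [Module R Q] : AddSubgroup (M ⊗[ℤ] Q) :=
  AddSubgroup.closure
    {x | ∃ (m : M) (r : R) (q : Q), x = (MulOpposite.op r • m) ⊗ₜ[ℤ] q - m ⊗ₜ[ℤ] (r • q)}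

/-- The tensor product `M ⊗_R Q` of a right module and a left module over a ring `R` that need
not be commutative, an abelian group. -/
abbrev Tensor (Q : Type w) [AddCommGroup Q] [Module R Q] : Type (max v w) :=
  (M ⊗[ℤ] Q) ⧸ balancedRel R M Q

variable {R}

/-- The map `M ⊗_R f : M ⊗_R Q → M ⊗_R Q'`, `m ⊗ q ↦ m ⊗ f q`. -/
def Tensor.map {Q : Type w} [AddCommGroup Q] [Module R Q] {Q' : Type w'} [AddCommGroup Q']
    [Module R Q'] (f : Q →ₗ[R] Q') : Tensor R M Q →+ Tensor R M Q' :=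
  QuotientAddGroup.map (balancedRel R M Q) (balancedRel R M Q')
    (TensorProduct.map (LinearMap.id : M →ₗ[ℤ] M)
      f.toAddMonoidHom.toIntLinearMap).toAddMonoidHom (by
        rw [balancedRel, AddSubgroup.closure_le]
        rintro _ ⟨m, r, q, rfl⟩
        exact AddSubgroup.subset_closure ⟨m, r, f q, by simp⟩)

variable (R)

/-- The canonical map `ρ : M ⊗_R ∏ Q_i → ∏ (M ⊗_R Q_i)`, `m ⊗ (q_i) ↦ (m ⊗ q_i)`. -/
def rho {I : Type w'} (Q : I → Type w) [∀ i, AddCommGroup (Q i)] [∀ i, Module R (Q i)] :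
    Tensor R M (∀ i, Q i) →+ ∀ i, Tensor R M (Q i) :=
  AddMonoidHom.pi fun i => Tensor.map M (LinearMap.proj (R := R) (φ := Q) i)

/-- The right module `M` is flat: `M ⊗_R -` preserves monomorphisms of left modules
(in the universe `w`). -/
def IsFlat : Prop :=
  ∀ (N P : Type w) [AddCommGroup N] [AddCommGroup P] [Module R N] [Module R P] (f : N →ₗ[R] P),
    Function.Injective f → Function.Injective (Tensor.map M f)

/-- The right module `M` is Mittag-Leffler: `ρ` is monic for each family of left modules
(in the universe `w`). -/
def IsMittagLeffler : Prop :=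
  ∀ (I : Type w) (Q : I → Type w) [∀ i, AddCommGroup (Q i)] [∀ i, Module R (Q i)],
    Function.Injective (rho R M Q)

end Tensor

section Dense

variable {S : Type u} [Ring S] {M : Type v} [AddCommGroup M] [Module S M]

/-- A `κ`-dense system of submodules of `M`. The supremum in `chain` is the union, since the
family is a nonempty chain; a well-ordered set has order type `< κ` iff it has fewer than `κ`
elements. -/
structure IsDenseSystem (κ : Cardinal.{v}) (C : Set (Submodule S M)) : Prop where
  directed : DirectedOn (· ≤ ·) C
  chain : ∀ (ι : Type v) [LinearOrder ι] [WellFoundedLT ι] [Nonempty ι], Cardinal.mk ι < κ →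
    ∀ F : ι → Submodule S M, Monotone F → (∀ i, F i ∈ C) → (⨆ i, F i) ∈ C
  cover : ∀ X : Set M, Cardinal.mk X < κ → ∃ N ∈ C, X ⊆ (N : Set M)

/-- The submodule `N` has a generating set with fewer than `κ` elements. -/
def IsLTGenerated (κ : Cardinal.{v}) (N : Submodule S M) : Prop :=
  ∃ X : Set M, Cardinal.mk X < κ ∧ Submodule.span S X = N

variable (S M)

/-- `M` has a `κ`-dense system of `< κ`-generated projective submodules
(used for `κ` regular and uncountable). -/
def IsKappaProjective (κ : Cardinal.{v}) : Prop :=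
  ∃ C : Set (Submodule S M), IsDenseSystem κ C ∧
    ∀ N ∈ C, IsLTGenerated κ N ∧ Module.Projective S N

end Dense

end MLModule

/-! Both properties are compared with a third, `IsStable`: every map `f` from a finitely generated
free module to `M` factors as `g ∘ u` through some `S^n`, where `u` kills `ker f` and itself factors
through the first map of every finite free factorization of `f`. This is a Mittag-Leffler condition
on the finite free modules over `M`.

From `κ`-projective to stable: projective modules are stable by a dual basis argument. If stability
failed for `M`, the dense system would contain a countable chain along which the factorizations of
some `f` never settle. The union of the chain lies in the system because `ℵ₀ < κ`, and its own
stable factorization already lives in one member of the chain, a contradiction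
(`isStable_of_isDenseSystem`).

From stable to `ℵ₁`-projective: countable sets can be closed up so that their spans contain stable
factorizations (`exists_containsStable`). A countably generated stable module is the limit of a
sequence of finite free modules, along which lifts to a free cover can be corrected until they
agree, so the cover splits (`projective_of_isStable_of_countable`).

Stable against flat Mittag-Leffler: in a stable factorization `u` kills every tensor that `f` kills,
so injectivity questions for `M ⊗ -` pass to `S^n`, where coordinates answer them. Conversely,
flatness and injectivity of `rho` give a smallest `L₀ ≤ R^ι` for which `∑ m_j ⊗ e_j` dies in `M ⊗
(R^ι / L₀)`. Finitely many elements of `L₀` form the matrix of `u`, and minimality of `L₀` yields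
both conditions on `u`. -/

namespace MLModule

/-! ### Stable factorizations of maps from finite free modules -/

section StableFactorization

open LinearMap

variable {S : Type u} [Ring S] {M : Type v} [AddCommGroup M] [Module S M]
  {F : Type u} [AddCommGroup F] [Module S F] {G : Type u} [AddCommGroup G] [Module S G]

/-- `u` factors through the first map of every factorization of `f` through a finitely generated
free module whose second map takes values in `N`. -/
def IsDominating (N : Submodule S M) (f : F →ₗ[S] M) (u : F →ₗ[S] G) : Prop :=
  ∀ (H : Type u) [AddCommGroup H] [Module S H] [Module.Free S H] [Module.Finite S H]
    (uH : F →ₗ[S] H) (gH : H →ₗ[S] M), range gH ≤ N → gH ∘ₗ uH = f →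
      ∃ B : H →ₗ[S] G, B ∘ₗ uH = u

/-- The factorization `f = g ∘ u` has the same kernel as `f`, and `u` factors through the first
map of every factorization of `f` through a finitely generated free module inside `N`. -/
structure IsStableFactorization (N : Submodule S M) (f : F →ₗ[S] M) (u : F →ₗ[S] G)
    (g : G →ₗ[S] M) : Prop where
  comp : g ∘ₗ u = f
  ker_le : ker f ≤ ker u
  dominating : IsDominating N f u

variable (S M) in
/-- Every map from a finitely generated free module to `M` has a stable factorization. -/
def IsStable : Prop :=
  ∀ (F : Type u) [AddCommGroup F] [Module S F] [Module.Free S F] [Module.Finite S F]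
    (f : F →ₗ[S] M), ∃ (n : ℕ) (u : F →ₗ[S] (Fin n → S)) (g : (Fin n → S) →ₗ[S] M),
      IsStableFactorization ⊤ f u g

theorem range_fg [Module.Finite S F] (f : F →ₗ[S] M) : (range f).FG := by
  rw [range_eq_map]
  exact Module.Finite.fg_top.map f

theorem exists_range_le_of_directed [Module.Finite S F] (f : F →ₗ[S] M) {ι : Type w} [Nonempty ι]
    {N : ι → Submodule S M} (hN : Directed (· ≤ ·) N) (hf : range f ≤ ⨆ i, N i) :
    ∃ i, range f ≤ N i := by
  have h := (Submodule.fg_iff_compact _).1 (range_fg f)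
  rw [CompleteLattice.isCompactElement_iff_le_of_directed_sSup_le] at h
  obtain ⟨_, ⟨i, rfl⟩, hi⟩ := h (Set.range N) (Set.range_nonempty N)
    hN.directedOn_range (by rwa [sSup_range])
  exact ⟨i, hi⟩

/-- A map from a finitely generated free module into `span X` factors through a finite tuple of
distinct elements of `X`. -/
theorem exists_factor_span [Module.Free S F] [Module.Finite S F] (f : F →ₗ[S] M) {X : Set M}
    (hf : range f ≤ Submodule.span S X) :
    ∃ (n : ℕ) (x : Fin n → M) (b : F →ₗ[S] (Fin n → S)), Function.Injective x ∧
      (∀ i, x i ∈ X) ∧ Fintype.linearCombination S x ∘ₗ b = f := by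
  classical
  obtain ⟨t, ht⟩ := range_fg f
  obtain ⟨s, hsX, hs⟩ := Submodule.subset_span_finite_of_subset_span (R := S) (s := X) (t := t)
    (Submodule.subset_span.trans (ht.le.trans hf))
  let x : Fin s.card → M := fun i => (s.equivFin.symm i : M)
  have hx : Set.range x = s := by
    ext m
    constructor
    · rintro ⟨i, rfl⟩
      exact (s.equivFin.symm i).2
    · intro hm
      exact ⟨s.equivFin ⟨m, hm⟩, by simp [x]⟩
  have hr : range f ≤ range (Fintype.linearCombination S x) := by
    rw [Fintype.range_linearCombination, hx, ← ht, Submodule.span_le]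
    exact hs
  obtain ⟨b, hb⟩ := Module.projective_lifting_property
    (Fintype.linearCombination S x).rangeRestrict
    (f.codRestrict (range (Fintype.linearCombination S x)) fun c => hr ⟨c, rfl⟩)
    (LinearMap.surjective_rangeRestrict _)
  refine ⟨s.card, x, b, Subtype.val_injective.comp s.equivFin.symm.injective,
    fun i => hsX (s.equivFin.symm i).2, ?_⟩
  ext c
  exact congrArg Subtype.val (LinearMap.congr_fun hb c)

/-- Finitely generated maps into a projective module factor through a finite free module on which
the factorization is recovered by a map defined on the whole module. -/
theorem exists_factor_of_projective [Module.Projective S M] [Module.Free S F] [Module.Finite S F]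
    (f : F →ₗ[S] M) : ∃ (n : ℕ) (r : M →ₗ[S] (Fin n → S)) (g : (Fin n → S) →ₗ[S] M),
      g ∘ₗ r ∘ₗ f = f := by
  classical
  obtain ⟨s, hs⟩ := Module.projective_def'.1 (inferInstance : Module.Projective S M)
  obtain ⟨n, x, b, hinj, hx, hb⟩ := exists_factor_span (s ∘ₗ f)
    (X := Set.range fun m => Finsupp.single m (1 : S)) (fun y _ => by
      have := (Finsupp.basisSingleOne (R := S) (ι := M)).span_eq
      rw [Finsupp.coe_basisSingleOne] at this
      rw [this]
      trivial)
  choose m hm using hx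
  have hm' : Function.Injective m := fun i j h => hinj (by rw [← hm, ← hm, h])
  -- Since the basis vectors are distinct, reading off their coordinates is a left inverse of the
  -- inclusion of their span.
  let p : (M →₀ S) →ₗ[S] (Fin n → S) := LinearMap.pi fun i => Finsupp.lapply (m i)
  have hp : p ∘ₗ Fintype.linearCombination S x = LinearMap.id := by
    ext i j
    simp [p, ← hm, Finsupp.single_apply, Pi.single_apply, hm'.eq_iff, eq_comm]
  refine ⟨n, p ∘ₗ s, Finsupp.linearCombination S _root_.id ∘ₗ Fintype.linearCombination S x, ?_⟩
  have : Fintype.linearCombination S x ∘ₗ p ∘ₗ (s ∘ₗ f) = s ∘ₗ f := by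
    rw [← hb, ← LinearMap.comp_assoc b, hp, LinearMap.id_comp]
  calc
    _ = Finsupp.linearCombination S _root_.id ∘ₗ
        (Fintype.linearCombination S x ∘ₗ p ∘ₗ (s ∘ₗ f)) := rfl
    _ = (Finsupp.linearCombination S _root_.id ∘ₗ s) ∘ₗ f := by rw [this]; rfl
    _ = f := by rw [hs, LinearMap.id_comp]

/-- The first map is `r ∘ f` with `r` defined on all of `M`, so for `f = g' ∘ u'` the composite `r ∘
g'` is the required map. -/
theorem isStable_of_projective [Module.Projective S M] : IsStable S M := by
  intro F _ _ _ _ f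
  obtain ⟨n, r, g, h⟩ := exists_factor_of_projective f
  refine ⟨n, r ∘ₗ f, g, h, fun c hc => ?_, ?_⟩
  · rw [LinearMap.mem_ker] at hc ⊢
    simp [hc]
  · rintro H _ _ _ _ u' g' - rfl
    exact ⟨r ∘ₗ g', rfl⟩

theorem IsStableFactorization.precomp [Module.Free S F] [Module.Finite S F] (hM : IsStable S M)
    {f : F →ₗ[S] M} {u : F →ₗ[S] G} {g : G →ₗ[S] M} (h : IsStableFactorization ⊤ f u g)
    {E : Type u} [AddCommGroup E] [Module S E] (b : E →ₗ[S] F) :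
    IsStableFactorization ⊤ (f ∘ₗ b) (u ∘ₗ b) g where
  comp := by rw [← h.comp]; rfl
  ker_le := fun c hc => h.ker_le hc
  dominating := by
    intro H _ _ _ _ u' g' _ hg
    -- A stable factorization of `(f, g')` kills each `(b c, -u' c)`. This identifies `w ∘ inl ∘ b`
    -- with `w ∘ inr ∘ u'` and moves domination from `f` to `f ∘ b`.
    obtain ⟨n, w, k, hw⟩ := hM (F × H) (f.coprod g')
    have hfk : k ∘ₗ (w ∘ₗ inl S F H) = f := by
      rw [← LinearMap.comp_assoc, hw.comp, coprod_inl]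
    obtain ⟨B, hB⟩ := h.dominating _ (w ∘ₗ inl S F H) k le_top hfk
    refine ⟨B ∘ₗ w ∘ₗ inr S F H, LinearMap.ext fun c => ?_⟩
    have hc : w (b c, -u' c) = 0 := hw.ker_le (by
      have := LinearMap.congr_fun hg c
      simp only [LinearMap.comp_apply] at this
      simp [this])
    have h1 : w (inl S F H (b c)) = w (inr S F H (u' c)) := by
      rw [← sub_eq_zero, ← map_sub]
      simpa using hc
    have h2 := LinearMap.congr_fun hB (b c)
    simp only [LinearMap.comp_apply] at h2 ⊢
    rw [← h2, h1]

/-- In a submodule which is itself stable, stable factorizations can be computed. -/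
theorem exists_factorization_of_isStable {N : Submodule S M} (hN : IsStable S N)
    [Module.Free S F] [Module.Finite S F] (f : F →ₗ[S] M) (hf : range f ≤ N) :
    ∃ (n : ℕ) (u : F →ₗ[S] (Fin n → S)) (g : (Fin n → S) →ₗ[S] M),
      range g ≤ N ∧ IsStableFactorization N f u g := by
  obtain ⟨n, u, g, h⟩ := hN F (f.codRestrict N fun c => hf ⟨c, rfl⟩)
  refine ⟨n, u, N.subtype ∘ₗ g, ?_, ?_, ?_, ?_⟩
  · rintro _ ⟨c, rfl⟩
    exact (g c).2
  · rw [LinearMap.comp_assoc, h.comp]; rfl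
  · rw [← LinearMap.ker_codRestrict N f fun c => hf ⟨c, rfl⟩]
    exact h.ker_le
  · intro H _ _ _ _ u' g' hg' hc
    refine h.dominating H u' (g'.codRestrict N fun c => hg' ⟨c, rfl⟩) le_top ?_
    ext c
    exact LinearMap.congr_fun hc c

theorem isStable_of_exists_factorization {N : Submodule S M}
    (hN : ∀ (F : Type u) [AddCommGroup F] [Module S F] [Module.Free S F] [Module.Finite S F]
      (f : F →ₗ[S] M), range f ≤ N → ∃ (n : ℕ) (u : F →ₗ[S] (Fin n → S))
        (g : (Fin n → S) →ₗ[S] M), range g ≤ N ∧ IsStableFactorization ⊤ f u g) :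
    IsStable S N := by
  intro F _ _ _ _ f
  obtain ⟨n, u, g, hg, h⟩ := hN F (N.subtype ∘ₗ f) (by rintro _ ⟨c, rfl⟩; exact (f c).2)
  refine ⟨n, u, g.codRestrict N fun c => hg ⟨c, rfl⟩, ?_, ?_, ?_⟩
  · ext c
    exact LinearMap.congr_fun h.comp c
  · intro c hc
    exact h.ker_le (by rw [LinearMap.mem_ker] at hc; simp [hc])
  · intro H _ _ _ _ u' g' _ hc
    exact h.dominating H u' (N.subtype ∘ₗ g') le_top (by rw [← hc]; rfl)

end StableFactorization

/-! ### Stability passes from a dense system to the whole module -/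

section KappaProjective

open LinearMap

variable {S : Type u} [Ring S] {M : Type v} [AddCommGroup M] [Module S M]

/-- A member `N` of a dense system together with a stable factorization, relative to `N`, of a
fixed map `f`. -/
structure FactorizationIn (C : Set (Submodule S M)) {F : Type u} [AddCommGroup F] [Module S F]
    (f : F →ₗ[S] M) where
  N : Submodule S M
  mem : N ∈ C
  n : ℕ
  u : F →ₗ[S] (Fin n → S)
  g : (Fin n → S) →ₗ[S] M
  range_le : range g ≤ N
  stable : IsStableFactorization N f u g

theorem FactorizationIn.range_map_le {C : Set (Submodule S M)} {F : Type u} [AddCommGroup F]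
    [Module S F] {f : F →ₗ[S] M} (s : FactorizationIn C f) : range f ≤ s.N := by
  rintro _ ⟨c, rfl⟩
  exact s.range_le ⟨s.u c, LinearMap.congr_fun s.stable.comp c⟩

theorem IsDenseSystem.exists_range_le {κ : Cardinal.{v}} {C : Set (Submodule S M)}
    (hC : IsDenseSystem κ C) (hκ : Cardinal.aleph0 < κ) {F : Type u} [AddCommGroup F]
    [Module S F] [Module.Finite S F] (f : F →ₗ[S] M) : ∃ N ∈ C, range f ≤ N := by
  obtain ⟨t, ht⟩ := range_fg f
  obtain ⟨N, hN, h⟩ := hC.cover t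
    (lt_of_le_of_lt (Cardinal.le_aleph0_iff_set_countable.2 t.countable_toSet) hκ)
  exact ⟨N, hN, by rw [← ht, Submodule.span_le]; exact h⟩

theorem isStable_of_isDenseSystem {κ : Cardinal.{v}} (hκ : Cardinal.aleph0 < κ)
    {C : Set (Submodule S M)} (hC : IsDenseSystem κ C) (hP : ∀ N ∈ C, IsStable S N) :
    IsStable S M := by
  intro F _ _ _ _ f
  by_contra hcon
  have fact : ∀ N ∈ C, range f ≤ N → ∃ s : FactorizationIn C f, s.N = N := by
    intro N hN hf
    obtain ⟨n, u, g, hg, h⟩ := exists_factorization_of_isStable (hP N hN) f hf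
    exact ⟨⟨N, hN, n, u, g, hg, h⟩, rfl⟩
  -- A factorization through `H` that refutes domination by `s.u` has its image in some larger
  -- member of `C`, and any stable factorization there is a strict refinement.
  have step : ∀ s : FactorizationIn C f, ∃ s' : FactorizationIn C f, s.N ≤ s'.N ∧
      ∀ B : (Fin s'.n → S) →ₗ[S] (Fin s.n → S), B ∘ₗ s'.u ≠ s.u := by
    intro s
    have hs : ¬ IsDominating ⊤ f s.u := fun h =>
      hcon ⟨s.n, s.u, s.g, s.stable.comp, s.stable.ker_le, h⟩
    unfold IsDominating at hs
    push Not at hs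
    obtain ⟨H, _, _, _, _, u', g', -, hg', hB⟩ := hs
    obtain ⟨N₁, hN₁, hle₁⟩ := hC.exists_range_le hκ g'
    obtain ⟨N, hN, hle, hle'⟩ := hC.directed s.N s.mem N₁ hN₁
    obtain ⟨s', rfl⟩ := fact N hN (s.range_map_le.trans hle)
    refine ⟨s', hle, fun B hBs => ?_⟩
    obtain ⟨B', hB'⟩ := s'.stable.dominating H u' g' (hle₁.trans hle') hg'
    exact hB (B ∘ₗ B') (by rw [LinearMap.comp_assoc, hB', hBs])
  choose next hle hne using step
  obtain ⟨N₀, hN₀, hf₀⟩ := hC.exists_range_le hκ f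
  obtain ⟨s₀, rfl⟩ := fact N₀ hN₀ hf₀
  let s : ℕ → FactorizationIn C f := fun k => Nat.rec s₀ (fun _ => next) k
  have hmono : Monotone fun k => (s k).N := monotone_nat_of_le_succ fun k => hle (s k)
  have hdir : Directed (· ≤ ·) fun k : ULift.{v} ℕ => (s k.down).N :=
    Monotone.directed_le fun a b h => hmono h
  have hmem : (⨆ k : ULift.{v} ℕ, (s k.down).N) ∈ C :=
    hC.chain (ULift.{v} ℕ) (by simpa using hκ) _ (fun a b h => hmono h) fun k => (s k.down).mem
  have hleN : ∀ k, (s k).N ≤ ⨆ k : ULift.{v} ℕ, (s k.down).N := fun k =>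
    le_iSup (fun k : ULift.{v} ℕ => (s k.down).N) ⟨k⟩
  obtain ⟨t, ht⟩ := fact _ hmem ((s 0).range_map_le.trans (hleN 0))
  -- The range of `t.g` is finitely generated, hence inside one stage `k`. Then `u_k` factors
  -- through `t.u`, which factors through `u_{k+1}`, against the choice of stage `k + 1`.
  obtain ⟨⟨k⟩, hk⟩ := exists_range_le_of_directed t.g hdir (ht ▸ t.range_le)
  obtain ⟨B₁, h₁⟩ := (s k).stable.dominating _ t.u t.g hk t.stable.comp
  obtain ⟨B₂, h₂⟩ := t.stable.dominating _ (s (k + 1)).u (s (k + 1)).g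
    ((s (k + 1)).range_le.trans (ht ▸ hleN (k + 1))) (s (k + 1)).stable.comp
  exact hne (s k) (B₁ ∘ₗ B₂) (by
    change (B₁ ∘ₗ B₂) ∘ₗ (s (k + 1)).u = (s k).u
    rw [LinearMap.comp_assoc, h₂, h₁])

theorem IsKappaProjective.isStable {κ : Cardinal.{v}} (hκ : Cardinal.aleph0 < κ)
    (h : IsKappaProjective S M κ) : IsStable S M := by
  obtain ⟨C, hC, hP⟩ := h
  refine isStable_of_isDenseSystem hκ hC fun N hN => ?_
  have := (hP N hN).2
  exact isStable_of_projective

end KappaProjective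

/-! ### Countably generated stable modules are projective -/

section CountablyGenerated

open LinearMap

variable {S : Type u} [Ring S] {M : Type v} [AddCommGroup M] [Module S M]

variable (S M) in
/-- A finite free module with a map to `M`. -/
structure FreeOver where
  n : ℕ
  map : (Fin n → S) →ₗ[S] M

/-- An extra free coordinate mapping to `x` is added to the target of a stable factorization.
Composing with the inclusion `inr` preserves kernels and domination. -/
theorem exists_next_freeOver (hM : IsStable S M) (s : FreeOver S M) (x : M) :
    ∃ (s' : FreeOver S M) (A : (Fin s.n → S) →ₗ[S] (Fin s'.n → S)),
      IsStableFactorization ⊤ s.map A s'.map ∧ x ∈ range s'.map := by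
  obtain ⟨m, u, g, h⟩ := hM _ s.map
  let e := Fin.consLinearEquiv S (fun _ : Fin (m + 1) => S)
  let z : (Fin (m + 1) → S) →ₗ[S] M := (toSpanSingleton S M x).coprod g ∘ₗ e.symm.toLinearMap
  refine ⟨⟨m + 1, z⟩, e.toLinearMap ∘ₗ inr S S (Fin m → S) ∘ₗ u, ⟨?_, ?_, ?_⟩, ?_⟩
  · rw [← h.comp]
    ext c
    simp [z]
  · intro c hc
    have := h.ker_le hc
    rw [LinearMap.mem_ker] at this ⊢
    simp [this]
  · intro H _ _ _ _ u' g' hg hc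
    obtain ⟨B, hB⟩ := h.dominating H u' g' hg hc
    exact ⟨e.toLinearMap ∘ₗ inr S S (Fin m → S) ∘ₗ B, by rw [← hB]; rfl⟩
  · exact ⟨e (1, 0), by simp [z]⟩

/-- A linear map on `M` may be defined on the stages of a countable direct system whose limit
is `M`. -/
theorem exists_linearMap_of_system {P : Type w} [AddCommGroup P] [Module S P] (n : ℕ → ℕ)
    (z : ∀ k, (Fin (n k) → S) →ₗ[S] M) (h : ∀ k, (Fin (n k) → S) →ₗ[S] P)
    (A : ∀ k, (Fin (n k) → S) →ₗ[S] (Fin (n (k + 1)) → S))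
    (hz : ∀ k, z (k + 1) ∘ₗ A k = z k) (hh : ∀ k, h (k + 1) ∘ₗ A k = h k)
    (hker : ∀ k, ker (z k) ≤ ker (h k)) (hsurj : ∀ x, ∃ k, x ∈ range (z k)) :
    ∃ s : M →ₗ[S] P, ∀ k, s ∘ₗ z k = h k := by
  have shift : ∀ k c j, k ≤ j → ∃ c', z j c' = z k c ∧ h j c' = h k c := by
    intro k c j hkj
    induction j, hkj using Nat.le_induction with
    | base => exact ⟨c, rfl, rfl⟩
    | succ j _ ih =>
      obtain ⟨c', h1, h2⟩ := ih
      exact ⟨A j c', by rw [← h1, ← hz j]; rfl, by rw [← h2, ← hh j]; rfl⟩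
  -- Two representatives are moved to a common stage, where their difference lies in `ker z ≤ ker
  -- h`.
  have wd : ∀ k c l d, z k c = z l d → h k c = h l d := by
    intro k c l d hcd
    obtain ⟨c', h1, h2⟩ := shift k c _ (le_max_left k l)
    obtain ⟨d', h3, h4⟩ := shift l d _ (le_max_right k l)
    rw [← h2, ← h4, ← sub_eq_zero, ← map_sub]
    apply hker
    rw [LinearMap.mem_ker, map_sub, h1, h3, hcd, sub_self]
  choose k c hkc using hsurj
  refine ⟨{ toFun := fun x => h (k x) (c x)
            map_add' := fun x y => ?_
            map_smul' := fun r x => ?_ },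
    fun l => LinearMap.ext fun d => wd _ _ _ _ (hkc _)⟩
  · obtain ⟨c', h1, h2⟩ := shift _ (c x) _ (le_max_left (k x) (k y))
    obtain ⟨d', h3, h4⟩ := shift _ (c y) _ (le_max_right (k x) (k y))
    rw [← h2, ← h4, ← map_add]
    apply wd
    rw [hkc, map_add, h1, h3, hkc, hkc]
  · rw [RingHom.id_apply, ← map_smul]
    apply wd
    rw [hkc, map_smul, hkc]

theorem projective_of_isStable_of_countable (hM : IsStable S M) (x : ℕ → M)
    (hx : Submodule.span S (Set.range x) = ⊤) : Module.Projective S M := by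
  choose next A hA hmem using exists_next_freeOver hM
  let s : ℕ → FreeOver S M := fun k =>
    Nat.rec ⟨0, 0⟩ (fun k s => next s (x k)) k
  let a : ∀ k, (Fin (s k).n → S) →ₗ[S] (Fin (s (k + 1)).n → S) := fun k => A (s k) (x k)
  have ha : ∀ k, IsStableFactorization ⊤ (s k).map (a k) (s (k + 1)).map := fun k => hA _ _
  have hxs : ∀ k, x k ∈ range (s (k + 1)).map := fun k => hmem _ _
  have hmono : Monotone fun k => range (s k).map := monotone_nat_of_le_succ fun k => by
    rw [← (ha k).comp]
    exact range_comp_le_range _ _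
  have hsurj : ∀ y, ∃ k, y ∈ range (s k).map := by
    intro y
    rw [← Submodule.mem_iSup_of_directed _ hmono.directed_le]
    have : Submodule.span S (Set.range x) ≤ ⨆ k, range (s k).map := by
      rw [Submodule.span_le]
      rintro _ ⟨k, rfl⟩
      exact (le_iSup (fun k => range (s k).map) (k + 1)) (hxs k)
    exact this (hx ▸ Submodule.mem_top)
  -- Going one stage further loses nothing: `a k` is recovered from `a (k + 1) ∘ a k`.
  have hB : ∀ k, ∃ B : (Fin (s (k + 2)).n → S) →ₗ[S] (Fin (s (k + 1)).n → S),
      B ∘ₗ a (k + 1) ∘ₗ a k = a k := fun k =>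
    (ha k).dominating _ (a (k + 1) ∘ₗ a k) (s (k + 2)).map le_top (by
      rw [← LinearMap.comp_assoc, (ha (k + 1)).comp, (ha k).comp])
  choose B hB using hB
  let p : (M →₀ S) →ₗ[S] M := Finsupp.linearCombination S _root_.id
  have hp : Function.Surjective p := Finsupp.linearCombination_id_surjective S M
  have lift : ∀ k, ∃ g : (Fin (s k).n → S) →ₗ[S] (M →₀ S), p ∘ₗ g = (s k).map := fun k =>
    Module.projective_lifting_property p _ hp
  choose l hl using lift
  -- `L k` lifts stage `k + 1`. The lift `l (k + 2)` is corrected by its discrepancy with `L k`,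
  -- carried back along `B k`. Since `p` kills the discrepancy the result is still a lift, and by
  -- `hB` it agrees with `L k` after precomposition with `a k`.
  let L : ∀ k, {g : (Fin (s (k + 1)).n → S) →ₗ[S] (M →₀ S) // p ∘ₗ g = (s (k + 1)).map} :=
    fun k => Nat.rec ⟨l 1, hl 1⟩ (fun k g =>
      ⟨l (k + 2) - (l (k + 2) ∘ₗ a (k + 1) - g.1) ∘ₗ B k, by
        rw [LinearMap.comp_sub, ← LinearMap.comp_assoc, LinearMap.comp_sub, g.2,
          ← LinearMap.comp_assoc, hl, (ha (k + 1)).comp, sub_self, LinearMap.zero_comp,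
          sub_zero]⟩) k
  have hL : ∀ k, ((L (k + 1)).1 ∘ₗ a (k + 1)) ∘ₗ a k = (L k).1 ∘ₗ a k := by
    intro k
    change ((l (k + 2) - (l (k + 2) ∘ₗ a (k + 1) - (L k).1) ∘ₗ B k) ∘ₗ a (k + 1)) ∘ₗ a k = _
    have : ((l (k + 2) ∘ₗ a (k + 1) - (L k).1) ∘ₗ B k) ∘ₗ a (k + 1) ∘ₗ a k =
        (l (k + 2) ∘ₗ a (k + 1) - (L k).1) ∘ₗ a k := by
      rw [LinearMap.comp_assoc, hB]
    rw [LinearMap.comp_assoc, LinearMap.sub_comp, this, LinearMap.sub_comp, LinearMap.comp_assoc]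
    exact LinearMap.ext fun c => by simp
  -- The maps used are `L k ∘ a k`: they are compatible by `hL` and vanish on the kernel of the
  -- stage map because `a k` does.
  obtain ⟨σ, hσ⟩ := exists_linearMap_of_system (fun k => (s k).n) (fun k => (s k).map)
    (fun k => (L k).1 ∘ₗ a k) a (fun k => (ha k).comp) hL (fun k c hc => by
      have := (ha k).ker_le hc
      rw [LinearMap.mem_ker] at this ⊢
      rw [LinearMap.comp_apply, this, map_zero]) hsurj
  refine Module.projective_def'.2 ⟨σ, LinearMap.ext fun y => ?_⟩
  obtain ⟨k, c, rfl⟩ := hsurj y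
  have h1 : σ ((s k).map c) = (L k).1 (a k c) := LinearMap.congr_fun (hσ k) c
  have h2 : p ((L k).1 (a k c)) = (s (k + 1)).map (a k c) := LinearMap.congr_fun (L k).2 _
  have h3 : (s (k + 1)).map (a k c) = (s k).map c := LinearMap.congr_fun (ha k).comp c
  change p (σ ((s k).map c)) = (s k).map c
  rw [h1, h2, h3]

end CountablyGenerated

/-! ### Stable modules are `ℵ₁`-projective -/

section AlephOne

open LinearMap Cardinal

variable {S : Type u} [Ring S] {M : Type v} [AddCommGroup M] [Module S M]

/-- The submodule `N` of `M` contains a stable factorization (with respect to `M`) of each map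
from a finitely generated free module to `N`. -/
def ContainsStable (N : Submodule S M) : Prop :=
  ∀ (F : Type u) [AddCommGroup F] [Module S F] [Module.Free S F] [Module.Finite S F]
    (f : F →ₗ[S] M), range f ≤ N → ∃ (n : ℕ) (u : F →ₗ[S] (Fin n → S))
      (g : (Fin n → S) →ₗ[S] M), range g ≤ N ∧ IsStableFactorization ⊤ f u g

theorem ContainsStable.projective {N : Submodule S M} (hN : ContainsStable N) {X : Set M}
    (hX : X.Countable) (hXN : Submodule.span S X = N) : Module.Projective S N := by
  subst hXN
  -- Inserting `0` makes the set nonempty, so that it can be enumerated by `ℕ`.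
  obtain ⟨x, hx⟩ := (hX.insert 0).exists_eq_range (Set.insert_nonempty _ _)
  have hspan : Submodule.span S (Set.range x) = Submodule.span S X := by
    rw [← hx, Submodule.span_insert_zero]
  have hxm : ∀ k, x k ∈ Submodule.span S X := fun k =>
    hspan ▸ Submodule.subset_span ⟨k, rfl⟩
  refine projective_of_isStable_of_countable (isStable_of_exists_factorization hN)
    (fun k => ⟨x k, hxm k⟩) ?_
  apply Submodule.map_injective_of_injective (Submodule.span S X).injective_subtype
  rw [Submodule.map_span, Submodule.map_top, Submodule.range_subtype, ← Set.range_comp]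
  exact hspan

theorem containsStable_iSup {ι : Type w} [Nonempty ι] {N : ι → Submodule S M}
    (hd : Directed (· ≤ ·) N) (hN : ∀ i, ContainsStable (N i)) : ContainsStable (⨆ i, N i) := by
  intro F _ _ _ _ f hf
  obtain ⟨i, hi⟩ := exists_range_le_of_directed f hd hf
  obtain ⟨n, u, g, hg, h⟩ := hN i F f hi
  exact ⟨n, u, g, hg.trans (le_iSup N i), h⟩

theorem exists_containsStable (hM : IsStable S M) (X : Set M) (hX : X.Countable) :
    ∃ Y : Set M, X ⊆ Y ∧ Y.Countable ∧ ContainsStable (Submodule.span S Y) := by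
  -- Factorizations are chosen for finite tuples only, since a countable set has countably many of
  -- them. Other maps into the span factor through a tuple and are handled by `precomp`.
  have key : ∀ p : Σ n : ℕ, Fin n → M, ∃ (m : ℕ) (u : (Fin p.1 → S) →ₗ[S] (Fin m → S))
      (g : (Fin m → S) →ₗ[S] M),
      IsStableFactorization ⊤ (Fintype.linearCombination S p.2) u g := fun p => hM _ _
  choose m u g h using key
  let y : (Σ n : ℕ, Fin n → M) → Set M := fun p =>
    Set.range fun i : Fin (m p) => g p (Pi.single i 1)
  have hy : ∀ p, range (g p) ≤ Submodule.span S (y p) := by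
    rintro p _ ⟨c, rfl⟩
    rw [pi_eq_sum_univ' c, map_sum]
    refine Submodule.sum_mem _ fun i _ => ?_
    rw [map_smul]
    refine Submodule.smul_mem _ _ (Submodule.subset_span ⟨i, ?_⟩)
    congr 1
  let cl : Set M → Set M := fun Z =>
    Z ∪ ⋃ (n : ℕ) (t : Fin n → Z), y ⟨n, fun i => t i⟩
  have hcl : ∀ Z, Z.Countable → (cl Z).Countable := by
    intro Z hZ
    have := hZ.to_subtype
    exact hZ.union (Set.countable_iUnion fun n => Set.countable_iUnion fun t =>
      Set.countable_range _)
  let Z : ℕ → Set M := fun k => cl^[k] X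
  have hZs : ∀ k, Z (k + 1) = cl (Z k) := fun k => Function.iterate_succ_apply' cl k X
  have hZc : ∀ k, (Z k).Countable := by
    intro k
    induction k with
    | zero => exact hX
    | succ k ih => rw [hZs]; exact hcl _ ih
  have hZm : Monotone Z := monotone_nat_of_le_succ fun k => by
    rw [hZs]
    exact Set.subset_union_left
  refine ⟨⋃ k, Z k, Set.subset_iUnion Z 0, Set.countable_iUnion hZc, ?_⟩
  intro F _ _ _ _ f hf
  obtain ⟨n, x, b, -, hx, rfl⟩ := exists_factor_span f hf
  refine ⟨m ⟨n, x⟩, u ⟨n, x⟩ ∘ₗ b, g ⟨n, x⟩, (hy _).trans (Submodule.span_mono ?_),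
    (h ⟨n, x⟩).precomp hM b⟩
  have hk : ∃ k, ∀ i, x i ∈ Z k := by
    choose k hk using fun i => Set.mem_iUnion.1 (hx i)
    exact ⟨Finset.univ.sup k, fun i => hZm (Finset.le_sup (Finset.mem_univ i)) (hk i)⟩
  obtain ⟨k, hk⟩ := hk
  refine Set.Subset.trans ?_ (Set.subset_iUnion Z (k + 1))
  rw [hZs]
  refine Set.Subset.trans ?_ Set.subset_union_right
  exact Set.subset_iUnion₂_of_subset n (fun i => ⟨x i, hk i⟩) subset_rfl

/-- The system consists of the countably generated submodules with `ContainsStable`. It survives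
countable chains because a finitely generated image lies in one member. -/
theorem IsStable.isKappaProjective_aleph_one (hM : IsStable S M) :
    IsKappaProjective S M (ℵ_ 1) := by
  refine ⟨{N | ContainsStable N ∧ ∃ X : Set M, X.Countable ∧ Submodule.span S X = N},
    ⟨?_, ?_, ?_⟩, ?_⟩
  · rintro _ ⟨-, X, hX, rfl⟩ _ ⟨-, Y, hY, rfl⟩
    obtain ⟨Z, hZ, hZc, hs⟩ := exists_containsStable hM (X ∪ Y) (hX.union hY)
    exact ⟨_, ⟨hs, Z, hZc, rfl⟩, Submodule.span_mono (Set.subset_union_left.trans hZ),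
      Submodule.span_mono (Set.subset_union_right.trans hZ)⟩
  · intro ι _ _ _ hι N hN hmem
    have : Countable ι := mk_le_aleph0_iff.1 (lt_aleph_one_iff.1 hι)
    choose hs X hX hXN using hmem
    refine ⟨containsStable_iSup hN.directed_le hs, ⋃ i, X i, Set.countable_iUnion hX, ?_⟩
    simp_rw [Submodule.span_iUnion, hXN]
  · intro X hX
    obtain ⟨Z, hZ, hZc, hs⟩ := exists_containsStable hM X
      (le_aleph0_iff_set_countable.1 (lt_aleph_one_iff.1 hX))
    exact ⟨_, ⟨hs, Z, hZc, rfl⟩, hZ.trans Submodule.subset_span⟩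
  · rintro N ⟨hN, X, hX, hXN⟩
    exact ⟨⟨X, lt_aleph_one_iff.2 (le_aleph0_iff_set_countable.2 hX), hXN⟩, hN.projective hX hXN⟩

end AlephOne

/-! ### Tensor products over a noncommutative ring -/

section TensorAPI

open MulOpposite

variable {R : Type u} [Ring R] {M : Type v} [AddCommGroup M] [Module Rᵐᵒᵖ M]
  {Q : Type w} [AddCommGroup Q] [Module R Q]

variable (R) in
/-- The element `m ⊗ q` of `M ⊗_R Q`. -/
def tmul (m : M) (q : Q) : Tensor R M Q :=
  QuotientAddGroup.mk (m ⊗ₜ[ℤ] q)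

theorem add_tmul (m m' : M) (q : Q) : tmul R (m + m') q = tmul R m q + tmul R m' q := by
  simp only [tmul, TensorProduct.add_tmul, QuotientAddGroup.mk_add]

theorem tmul_add (m : M) (q q' : Q) : tmul R m (q + q') = tmul R m q + tmul R m q' := by
  simp only [tmul, TensorProduct.tmul_add, QuotientAddGroup.mk_add]

theorem smul_tmul (r : R) (m : M) (q : Q) : tmul R (op r • m) q = tmul R m (r • q) := by
  rw [tmul, tmul, ← sub_eq_zero, ← QuotientAddGroup.mk_sub, QuotientAddGroup.eq_zero_iff]
  exact AddSubgroup.subset_closure ⟨m, r, q, rfl⟩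

variable (R M Q) in
/-- The biadditive map `(m, q) ↦ m ⊗ q`. -/
def tmulHom : M →+ Q →+ Tensor R M Q :=
  AddMonoidHom.mk' (fun m => AddMonoidHom.mk' (tmul R m) (tmul_add m)) fun m m' =>
    AddMonoidHom.ext fun q => add_tmul m m' q

@[simp] theorem tmulHom_apply (m : M) (q : Q) : tmulHom R M Q m q = tmul R m q := rfl

@[simp] theorem tmul_zero (m : M) : tmul R m (0 : Q) = 0 := (tmulHom R M Q m).map_zero

@[simp] theorem zero_tmul (q : Q) : tmul R (0 : M) q = 0 := by
  rw [← tmulHom_apply, map_zero, AddMonoidHom.zero_apply]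

theorem neg_tmul (m : M) (q : Q) : tmul R (-m) q = -tmul R m q := by
  simp only [← tmulHom_apply, map_neg, AddMonoidHom.neg_apply]

theorem sum_tmul {ι : Type*} (s : Finset ι) (m : ι → M) (q : Q) :
    tmul R (∑ i ∈ s, m i) q = ∑ i ∈ s, tmul R (m i) q := by
  simp only [← tmulHom_apply, map_sum, AddMonoidHom.finsetSum_apply]

theorem tmul_sum {ι : Type*} (s : Finset ι) (m : M) (q : ι → Q) :
    tmul R m (∑ i ∈ s, q i) = ∑ i ∈ s, tmul R m (q i) := by
  simp only [← tmulHom_apply, map_sum]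

/-- The additive map on `M ⊗_R Q` induced by a balanced biadditive map. -/
def Tensor.lift {A : Type*} [AddCommGroup A] (φ : M →+ Q →+ A)
    (hφ : ∀ (r : R) m q, φ (op r • m) q = φ m (r • q)) : Tensor R M Q →+ A :=
  QuotientAddGroup.lift _ (TensorProduct.liftAddHom (R := ℤ) φ (by simp)) (by
    rw [balancedRel, AddSubgroup.closure_le]
    rintro _ ⟨m, r, q, rfl⟩
    simp [hφ])

@[simp] theorem Tensor.lift_tmul {A : Type*} [AddCommGroup A] (φ : M →+ Q →+ A)
    (hφ : ∀ (r : R) m q, φ (op r • m) q = φ m (r • q)) (m : M) (q : Q) :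
    Tensor.lift φ hφ (tmul R m q) = φ m q := by
  simp [Tensor.lift, tmul]

@[elab_as_elim]
theorem Tensor.induction {p : Tensor R M Q → Prop} (zero : p 0) (tmul : ∀ m q, p (tmul R m q))
    (add : ∀ x y, p x → p y → p (x + y)) (x : Tensor R M Q) : p x := by
  obtain ⟨x, rfl⟩ := QuotientAddGroup.mk_surjective x
  induction x using TensorProduct.induction_on with
  | zero => exact zero
  | tmul m q => exact tmul m q
  | add x y hx hy => exact add _ _ hx hy

theorem Tensor.hom_ext {A : Type*} [AddCommGroup A] {α β : Tensor R M Q →+ A}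
    (h : ∀ m q, α (tmul R m q) = β (tmul R m q)) : α = β := by
  refine DFunLike.ext _ _ fun x => ?_
  induction x using Tensor.induction with
  | zero => simp
  | tmul m q => exact h m q
  | add x y hx hy => rw [map_add, map_add, hx, hy]

@[simp] theorem Tensor.map_tmul {Q' : Type w'} [AddCommGroup Q'] [Module R Q'] (f : Q →ₗ[R] Q')
    (m : M) (q : Q) : Tensor.map M f (tmul R m q) = tmul R m (f q) := rfl

theorem Tensor.map_map {Q' : Type*} [AddCommGroup Q'] [Module R Q'] {Q'' : Type*}
    [AddCommGroup Q''] [Module R Q''] (f : Q →ₗ[R] Q') (f' : Q' →ₗ[R] Q'') (x : Tensor R M Q) :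
    Tensor.map M f' (Tensor.map M f x) = Tensor.map M (f' ∘ₗ f) x :=
  DFunLike.congr_fun (Tensor.hom_ext (α := (Tensor.map M f').comp (Tensor.map M f))
    fun m q => by simp) x

theorem Tensor.map_id (x : Tensor R M Q) : Tensor.map M (LinearMap.id : Q →ₗ[R] Q) x = x :=
  DFunLike.congr_fun (Tensor.hom_ext (β := AddMonoidHom.id _) fun m q => by simp) x

theorem Tensor.map_injective_of_leftInverse {Q' : Type*} [AddCommGroup Q'] [Module R Q']
    {f : Q →ₗ[R] Q'} {g : Q' →ₗ[R] Q} (h : g ∘ₗ f = LinearMap.id) :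
    Function.Injective (Tensor.map M f) :=
  Function.LeftInverse.injective (g := Tensor.map M g) fun x => by
    rw [Tensor.map_map, h, Tensor.map_id]

variable {M' : Type*} [AddCommGroup M'] [Module Rᵐᵒᵖ M'] {M'' : Type*} [AddCommGroup M'']
  [Module Rᵐᵒᵖ M'']

variable (Q) in
/-- The map `f ⊗_R Q : M ⊗_R Q → M' ⊗_R Q`. -/
def Tensor.lmap (f : M →ₗ[Rᵐᵒᵖ] M') : Tensor R M Q →+ Tensor R M' Q :=
  Tensor.lift ((tmulHom R M' Q).comp f.toAddMonoidHom) fun r m q => by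
    simp [smul_tmul]

@[simp] theorem Tensor.lmap_tmul (f : M →ₗ[Rᵐᵒᵖ] M') (m : M) (q : Q) :
    Tensor.lmap Q f (tmul R m q) = tmul R (f m) q :=
  Tensor.lift_tmul _ _ m q

theorem Tensor.lmap_lmap (f : M →ₗ[Rᵐᵒᵖ] M') (f' : M' →ₗ[Rᵐᵒᵖ] M'') (x : Tensor R M Q) :
    Tensor.lmap Q f' (Tensor.lmap Q f x) = Tensor.lmap Q (f' ∘ₗ f) x :=
  DFunLike.congr_fun (Tensor.hom_ext (α := (Tensor.lmap Q f').comp (Tensor.lmap Q f))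
    fun m q => by simp) x

theorem Tensor.map_lmap {Q' : Type*} [AddCommGroup Q'] [Module R Q'] (f : M →ₗ[Rᵐᵒᵖ] M')
    (g : Q →ₗ[R] Q') (x : Tensor R M Q) :
    Tensor.map M' g (Tensor.lmap Q f x) = Tensor.lmap Q' f (Tensor.map M g x) :=
  DFunLike.congr_fun (Tensor.hom_ext (α := (Tensor.map M' g).comp (Tensor.lmap Q f))
    (β := (Tensor.lmap Q' f).comp (Tensor.map M g)) fun m q => by simp) x

theorem exists_fin_sum_of_mem_closure {A : Type*} [AddCommGroup A] {s : Set A}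
    (hs : ∀ a ∈ s, -a ∈ s) {x : A} (hx : x ∈ AddSubgroup.closure s) :
    ∃ (n : ℕ) (a : Fin n → A), (∀ i, a i ∈ s) ∧ x = ∑ i, a i := by
  rw [← AddSubgroup.mem_toAddSubmonoid, AddSubgroup.closure_toAddSubmonoid] at hx
  obtain ⟨l, hl, rfl⟩ := AddSubmonoid.exists_list_of_mem_closure hx
  refine ⟨l.length, l.get, fun i => ?_, ?_⟩
  · rcases hl _ (l.get_mem i) with h | h
    · exact h
    · simpa using hs _ h
  · rw [← List.sum_ofFn, List.ofFn_get]

theorem Tensor.exists_fin_sum_of_mem_closure {p : M → Q → Prop} (hp : ∀ m q, p m q → p (-m) q)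
    {x : Tensor R M Q} (hx : x ∈ AddSubgroup.closure {y | ∃ m q, p m q ∧ y = tmul R m q}) :
    ∃ (n : ℕ) (m : Fin n → M) (q : Fin n → Q), (∀ i, p (m i) (q i)) ∧
      x = ∑ i, tmul R (m i) (q i) := by
  obtain ⟨n, a, ha, rfl⟩ := MLModule.exists_fin_sum_of_mem_closure (by
    rintro _ ⟨m, q, h, rfl⟩
    exact ⟨-m, q, hp m q h, (neg_tmul m q).symm⟩) hx
  choose m q h hmq using ha
  exact ⟨n, m, q, h, Finset.sum_congr rfl fun i _ => hmq i⟩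

theorem Tensor.exists_fin_sum (x : Tensor R M Q) :
    ∃ (n : ℕ) (m : Fin n → M) (q : Fin n → Q), x = ∑ i, tmul R (m i) (q i) := by
  have hx : x ∈ AddSubgroup.closure {y | ∃ (m : M) (q : Q), True ∧ y = tmul R m q} := by
    induction x using Tensor.induction with
    | zero => exact zero_mem _
    | tmul m q => exact AddSubgroup.subset_closure ⟨m, q, trivial, rfl⟩
    | add x y hx hy => exact add_mem hx hy
  obtain ⟨n, m, q, -, h⟩ := Tensor.exists_fin_sum_of_mem_closure (fun _ _ h => h) hx
  exact ⟨n, m, q, h⟩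

/-- Every tensor comes from a finite free module. -/
theorem Tensor.exists_eq_lmap (x : Tensor R M Q) :
    ∃ (n : ℕ) (f : (Fin n → Rᵐᵒᵖ) →ₗ[Rᵐᵒᵖ] M) (t : Tensor R (Fin n → Rᵐᵒᵖ) Q),
      x = Tensor.lmap Q f t := by
  obtain ⟨n, m, q, rfl⟩ := x.exists_fin_sum
  refine ⟨n, Fintype.linearCombination Rᵐᵒᵖ m, ∑ i, tmul R (Pi.single i 1) (q i), ?_⟩
  simp [map_sum]

/-- Right exactness: modulo the subgroup `K` generated by the tensors `m ⊗ q` with `f m = 0`, a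
set-theoretic section of `f` induces a map from `M' ⊗ Q` through which the quotient map factors. -/
theorem Tensor.exists_of_lmap_eq_zero {f : M →ₗ[Rᵐᵒᵖ] M'} (hf : Function.Surjective f)
    {x : Tensor R M Q} (hx : Tensor.lmap Q f x = 0) :
    ∃ (n : ℕ) (c : Fin n → M) (q : Fin n → Q), (∀ i, f (c i) = 0) ∧
      x = ∑ i, tmul R (c i) (q i) := by
  apply Tensor.exists_fin_sum_of_mem_closure (p := fun m _ => f m = 0)
    (fun m q h => by rw [map_neg, h, neg_zero])
  set K := AddSubgroup.closure {y : Tensor R M Q | ∃ m q, f m = 0 ∧ y = tmul R m q}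
  have key : ∀ (m m' : M) (q : Q), f m = f m' →
      (QuotientAddGroup.mk (tmul R m q) : Tensor R M Q ⧸ K) =
        QuotientAddGroup.mk (tmul R m' q) := by
    intro m m' q h
    rw [← sub_eq_zero, ← QuotientAddGroup.mk_sub, QuotientAddGroup.eq_zero_iff]
    refine AddSubgroup.subset_closure ⟨m - m', q, by rw [map_sub, h, sub_self], ?_⟩
    rw [sub_eq_add_neg, sub_eq_add_neg, add_tmul, neg_tmul]
  choose σ hσ using hf
  let φ : Tensor R M' Q →+ Tensor R M Q ⧸ K := Tensor.lift
    (AddMonoidHom.mk' (fun m => (QuotientAddGroup.mk' K).comp (tmulHom R M Q (σ m)))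
      fun m m' => AddMonoidHom.ext fun q => by
        have := key (σ (m + m')) (σ m + σ m') q (by simp [hσ])
        rw [add_tmul] at this
        exact this)
    fun r m q => by
      have := key (σ (op r • m)) (op r • σ m) q (by simp [hσ])
      rw [smul_tmul] at this
      exact this
  have hφ : φ.comp (Tensor.lmap Q f) = QuotientAddGroup.mk' K := Tensor.hom_ext fun m q => by
    rw [AddMonoidHom.comp_apply, Tensor.lmap_tmul]
    exact (Tensor.lift_tmul _ _ _ _).trans (key _ _ q (hσ (f m)))
  rw [← QuotientAddGroup.eq_zero_iff]
  have := DFunLike.congr_fun hφ x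
  rw [AddMonoidHom.comp_apply, hx, map_zero] at this
  exact this.symm

theorem Tensor.exists_of_map_eq_zero {Q' : Type*} [AddCommGroup Q'] [Module R Q']
    {f : Q →ₗ[R] Q'} (hf : Function.Surjective f) {x : Tensor R M Q}
    (hx : Tensor.map M f x = 0) :
    ∃ (n : ℕ) (m : Fin n → M) (q : Fin n → Q), (∀ i, f (q i) = 0) ∧
      x = ∑ i, tmul R (m i) (q i) := by
  apply Tensor.exists_fin_sum_of_mem_closure (p := fun _ q => f q = 0) (fun m q h => h)
  set K := AddSubgroup.closure {y : Tensor R M Q | ∃ m q, f q = 0 ∧ y = tmul R m q}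
  have key : ∀ (m : M) (q q' : Q), f q = f q' →
      (QuotientAddGroup.mk (tmul R m q) : Tensor R M Q ⧸ K) =
        QuotientAddGroup.mk (tmul R m q') := by
    intro m q q' h
    rw [← sub_eq_zero, ← QuotientAddGroup.mk_sub, QuotientAddGroup.eq_zero_iff]
    refine AddSubgroup.subset_closure ⟨m, q - q', by rw [map_sub, h, sub_self], ?_⟩
    simp only [← tmulHom_apply, map_sub]
  choose σ hσ using hf
  let φ : Tensor R M Q' →+ Tensor R M Q ⧸ K := Tensor.lift
    (AddMonoidHom.mk' (fun m => AddMonoidHom.mk'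
        (fun q => (QuotientAddGroup.mk (tmul R m (σ q)) : Tensor R M Q ⧸ K)) fun q q' => by
          have := key m (σ (q + q')) (σ q + σ q') (by simp [hσ])
          rw [tmul_add] at this
          exact this)
      fun m m' => AddMonoidHom.ext fun q =>
        congrArg QuotientAddGroup.mk (add_tmul m m' (σ q)))
    fun r m q => by
      have := key m (σ (r • q)) (r • σ q) (by simp [hσ])
      rw [← smul_tmul] at this
      exact this.symm
  have hφ : φ.comp (Tensor.map M f) = QuotientAddGroup.mk' K := Tensor.hom_ext fun m q => by
    rw [AddMonoidHom.comp_apply, Tensor.map_tmul]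
    exact (Tensor.lift_tmul _ _ _ _).trans (key m _ _ (hσ (f q)))
  rw [← QuotientAddGroup.eq_zero_iff]
  have := DFunLike.congr_fun hφ x
  rw [AddMonoidHom.comp_apply, hx, map_zero] at this
  exact this.symm

section Coordinates

variable (R Q) in
/-- The coordinates `R^n ⊗_R Q → Q^n`. -/
def coord (n : ℕ) : Tensor R (Fin n → Rᵐᵒᵖ) Q →+ (Fin n → Q) :=
  Tensor.lift (AddMonoidHom.mk' (fun x => AddMonoidHom.mk' (fun q j => unop (x j) • q)
      fun q q' => by ext j; simp) fun x x' => by ext q j; simp [add_smul])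
    fun r x q => by ext j; simp [mul_smul]

@[simp] theorem coord_tmul (n : ℕ) (x : Fin n → Rᵐᵒᵖ) (q : Q) (j : Fin n) :
    coord R Q n (tmul R x q) j = unop (x j) • q := by
  simp [coord]

theorem coord_injective (n : ℕ) : Function.Injective (coord R Q n) := by
  let ψ : (Fin n → Q) →+ Tensor R (Fin n → Rᵐᵒᵖ) Q :=
    AddMonoidHom.mk' (fun q => ∑ j, tmul R (Pi.single j 1) (q j)) fun q q' => by
      simp [tmul_add, Finset.sum_add_distrib]
  have h : ψ.comp (coord R Q n) = AddMonoidHom.id _ := Tensor.hom_ext fun x q => by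
    simp only [ψ, AddMonoidHom.comp_apply, AddMonoidHom.mk'_apply, coord_tmul, ← smul_tmul,
      ← sum_tmul, AddMonoidHom.id_apply, op_unop]
    congr 1
    ext j
    simp [Finset.sum_apply, Pi.single_apply]
  exact Function.LeftInverse.injective (g := ψ) fun x => DFunLike.congr_fun h x

theorem coord_map {Q' : Type*} [AddCommGroup Q'] [Module R Q'] (n : ℕ) (f : Q →ₗ[R] Q')
    (x : Tensor R (Fin n → Rᵐᵒᵖ) Q) (j : Fin n) :
    coord R Q' n (Tensor.map _ f x) j = f (coord R Q n x j) := by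
  induction x using Tensor.induction with
  | zero => simp
  | tmul m q => simp
  | add x y hx hy => simp [hx, hy]

end Coordinates

end TensorAPI

/-! ### Stable modules are flat and Mittag-Leffler -/

section StableTensor

variable {R : Type u} [Ring R] {M : Type v} [AddCommGroup M] [Module Rᵐᵒᵖ M]

open LinearMap

/-- The first map of a stable factorization of `f` kills every tensor that `f` kills. -/
theorem IsStableFactorization.lmap_eq_zero (hM : IsStable Rᵐᵒᵖ M) {F G : Type u} [AddCommGroup F]
    [Module Rᵐᵒᵖ F] [Module.Free Rᵐᵒᵖ F] [Module.Finite Rᵐᵒᵖ F] [AddCommGroup G] [Module Rᵐᵒᵖ G]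
    {f : F →ₗ[Rᵐᵒᵖ] M} {u : F →ₗ[Rᵐᵒᵖ] G} {g : G →ₗ[Rᵐᵒᵖ] M}
    (h : IsStableFactorization ⊤ f u g) {Q : Type w} [AddCommGroup Q] [Module R Q]
    {t : Tensor R F Q} (ht : Tensor.lmap Q f t = 0) : Tensor.lmap Q u t = 0 := by
  let π : (M →₀ Rᵐᵒᵖ) →ₗ[Rᵐᵒᵖ] M := Finsupp.linearCombination Rᵐᵒᵖ _root_.id
  have hπ : Function.Surjective π := Finsupp.linearCombination_id_surjective Rᵐᵒᵖ M
  obtain ⟨f', hf'⟩ := Module.projective_lifting_property π f hπ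
  obtain ⟨n, c, q, hc, hcq⟩ := Tensor.exists_of_lmap_eq_zero hπ
    (x := Tensor.lmap Q f' t) (by rw [Tensor.lmap_lmap, hf', ht])
  -- Only finitely many elements of the free cover matter, so everything happens in one finite free
  -- module. A stable factorization of `π ∘ k` kills the relations `r (c i)`, and `u` factors
  -- through it.
  obtain ⟨m, r, k, hk⟩ := exists_factor_of_projective
    (f'.coprod (Fintype.linearCombination Rᵐᵒᵖ c))
  have hkf : k ∘ₗ r ∘ₗ f' = f' := by
    have := congrArg (· ∘ₗ inl Rᵐᵒᵖ F (Fin n → Rᵐᵒᵖ)) hk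
    simpa only [LinearMap.comp_assoc, coprod_inl] using this
  have hkc : ∀ i, k (r (c i)) = c i := fun i => by
    simpa using LinearMap.congr_fun hk (0, Pi.single i 1)
  obtain ⟨l, u₁, g₁, h₁⟩ := hM _ (π ∘ₗ k)
  obtain ⟨B, hB⟩ := h.dominating _ (u₁ ∘ₗ r ∘ₗ f') g₁ le_top (by
    rw [← LinearMap.comp_assoc, h₁.comp, LinearMap.comp_assoc, hkf, hf'])
  rw [← hB, ← Tensor.lmap_lmap, ← Tensor.lmap_lmap, ← Tensor.lmap_lmap, hcq]
  have hu : ∀ i, u₁ (r (c i)) = 0 := fun i => h₁.ker_le (by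
    rw [LinearMap.mem_ker, LinearMap.comp_apply, hkc, hc])
  simp [map_sum, hu]

theorem IsStable.isFlat (hM : IsStable Rᵐᵒᵖ M) : IsFlat.{u, v, w} R M := by
  intro N P _ _ _ _ φ hφ
  rw [injective_iff_map_eq_zero]
  intro x hx
  obtain ⟨n, f, t, rfl⟩ := x.exists_eq_lmap
  obtain ⟨m, u, g, h⟩ := hM _ f
  rw [Tensor.map_lmap] at hx
  have hu := h.lmap_eq_zero hM hx
  rw [← Tensor.map_lmap] at hu
  have : Tensor.lmap N u t = 0 := coord_injective m (by
    ext j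
    apply hφ
    rw [← coord_map, hu]
    simp)
  rw [← h.comp, ← Tensor.lmap_lmap, this, map_zero]

theorem IsStable.isMittagLeffler (hM : IsStable Rᵐᵒᵖ M) : IsMittagLeffler.{u, v, w} R M := by
  intro I Q _ _
  rw [injective_iff_map_eq_zero]
  intro x hx
  obtain ⟨n, f, t, rfl⟩ := x.exists_eq_lmap
  obtain ⟨m, u, g, h⟩ := hM _ f
  have hu : Tensor.lmap (∀ i, Q i) u t = 0 := coord_injective m (by
    ext j i
    have hi : Tensor.map M (LinearMap.proj (R := R) (φ := Q) i) (Tensor.lmap _ f t) = 0 :=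
      congrFun hx i
    rw [Tensor.map_lmap] at hi
    have hui := h.lmap_eq_zero hM hi
    rw [← Tensor.map_lmap] at hui
    have := coord_map m (LinearMap.proj (R := R) (φ := Q) i) (Tensor.lmap _ u t) j
    rw [hui] at this
    simpa using this.symm)
  rw [← h.comp, ← Tensor.lmap_lmap, hu, map_zero]

end StableTensor

/-! ### Flat Mittag-Leffler modules are stable -/

section FlatMittagLeffler

open MulOpposite LinearMap

variable {R : Type u} [Ring R] {M : Type v} [AddCommGroup M] [Module Rᵐᵒᵖ M]

theorem IsFlat.map_injective (hM : IsFlat.{u, v, max u v w} R M) {N P : Type u} [AddCommGroup N]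
    [AddCommGroup P] [Module R N] [Module R P] (f : N →ₗ[R] P) (hf : Function.Injective f) :
    Function.Injective (Tensor.map M f) := by
  let eN : ULift.{max v w} N ≃ₗ[R] N := ULift.moduleEquiv
  let eP : ULift.{max v w} P ≃ₗ[R] P := ULift.moduleEquiv
  have h := hM (ULift.{max v w} N) (ULift.{max v w} P)
    (eP.symm.toLinearMap ∘ₗ f ∘ₗ eN.toLinearMap)
    (eP.symm.injective.comp (hf.comp eN.injective))
  have h' : Function.Injective (Tensor.map M eN.symm.toLinearMap) :=
    Tensor.map_injective_of_leftInverse (g := eN.toLinearMap) (by ext; simp)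
  intro x y hxy
  apply h'
  apply h
  rw [Tensor.map_map, Tensor.map_map]
  have : (eP.symm.toLinearMap ∘ₗ f ∘ₗ eN.toLinearMap) ∘ₗ eN.symm.toLinearMap =
      eP.symm.toLinearMap ∘ₗ f := by ext; simp
  rw [this, ← Tensor.map_map, ← Tensor.map_map, hxy]

theorem IsMittagLeffler.eq_zero (hM : IsMittagLeffler.{u, v, max u v w} R M) {I : Type u}
    {Q : I → Type u} [∀ i, AddCommGroup (Q i)] [∀ i, Module R (Q i)]
    {x : Tensor R M (∀ i, Q i)}
    (hx : ∀ i, Tensor.map M (LinearMap.proj (R := R) (φ := Q) i) x = 0) : x = 0 := by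
  let J : Type (max u v w) := ULift.{max v w} I
  let Q' : J → Type (max u v w) := fun j => ULift.{max v w} (Q j.down)
  let E : (∀ i, Q i) →ₗ[R] (∀ j, Q' j) := LinearMap.pi fun j =>
    (ULift.moduleEquiv (R := R) (M := Q j.down)).symm.toLinearMap ∘ₗ LinearMap.proj j.down
  let E' : (∀ j, Q' j) →ₗ[R] (∀ i, Q i) := LinearMap.pi fun i =>
    (ULift.moduleEquiv (R := R) (M := Q i)).toLinearMap ∘ₗ
      LinearMap.proj (R := R) (φ := Q') ⟨i⟩
  have hE : E' ∘ₗ E = LinearMap.id := rfl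
  apply Tensor.map_injective_of_leftInverse (M := M) hE
  apply hM J Q'
  rw [map_zero, map_zero]
  ext j
  change Tensor.map M (LinearMap.proj (R := R) (φ := Q') j) (Tensor.map M E x) = 0
  rw [Tensor.map_map]
  change Tensor.map M ((ULift.moduleEquiv (R := R) (M := Q j.down)).symm.toLinearMap ∘ₗ
    LinearMap.proj (R := R) (φ := Q) j.down) x = 0
  rw [← Tensor.map_map, hx, map_zero]

theorem map_eq_sum_repr {S : Type*} [Ring S] {F N ι : Type*} [AddCommGroup F] [Module S F]
    [AddCommGroup N] [Module S N] [Fintype ι] (b : Module.Basis ι S F) (f : F →ₗ[S] N) (c : F) :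
    f c = ∑ j, b.repr c j • f (b j) := by
  conv_lhs => rw [← b.sum_repr c, map_sum]
  simp only [map_smul]

/-- The tensor `∑ m_j ⊗ e_j` in `M ⊗_R (R^ι / L)`. -/
def tupleTensor {ι : Type u} [Fintype ι] [DecidableEq ι] (m : ι → M)
    (L : Submodule R (ι → R)) : Tensor R M ((ι → R) ⧸ L) :=
  ∑ j, tmul R (m j) (L.mkQ (Pi.single j 1))

section tupleTensor

variable {ι : Type u} [Fintype ι] [DecidableEq ι]

theorem map_tupleTensor (m : ι → M) (L : Submodule R (ι → R)) {Q : Type w'} [AddCommGroup Q]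
    [Module R Q] (φ : ((ι → R) ⧸ L) →ₗ[R] Q) :
    Tensor.map M φ (tupleTensor m L) = ∑ j, tmul R (m j) (φ (L.mkQ (Pi.single j 1))) := by
  simp only [tupleTensor, map_sum, Tensor.map_tmul]

/-- There is a smallest submodule `L` of `R^ι` for which the tensor `∑ m_j ⊗ e_j` vanishes
in `M ⊗_R (R^ι / L)`. -/
theorem tupleTensor_sInf (hF : IsFlat.{u, v, max u v w} R M)
    (hM : IsMittagLeffler.{u, v, max u v w} R M) (m : ι → M) :
    tupleTensor m (sInf {L : Submodule R (ι → R) | tupleTensor m L = 0}) = 0 := by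
  set L₀ := sInf {L : Submodule R (ι → R) | tupleTensor m L = 0}
  let Q : {L : Submodule R (ι → R) // tupleTensor m L = 0} → Type u := fun L => (ι → R) ⧸ L.1
  let δ : (ι → R) →ₗ[R] (∀ L, Q L) := LinearMap.pi fun L => L.1.mkQ
  have hδ : ker δ = L₀ := by
    ext a
    rw [LinearMap.mem_ker, Submodule.mem_sInf]
    constructor
    · intro h L hL
      exact (Submodule.Quotient.mk_eq_zero L).1 (congrFun h ⟨L, hL⟩)
    · intro h
      funext L
      exact (Submodule.Quotient.mk_eq_zero L.1).2 (h L.1 L.2)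
  -- `R^ι / L₀` embeds in the product of all `R^ι / L`. Flatness keeps this injective after
  -- tensoring, and `rho` detects vanishing factor by factor.
  have hinj : Function.Injective (L₀.liftQ δ hδ.ge) := by
    rw [← LinearMap.ker_eq_bot, Submodule.ker_liftQ_eq_bot _ _ _ hδ.le]
  apply hF.map_injective _ hinj
  rw [map_zero]
  refine hM.eq_zero fun L => ?_
  rw [Tensor.map_map, map_tupleTensor]
  exact L.2

end tupleTensor

theorem isStable_of_isFlat_of_isMittagLeffler (hF : IsFlat.{u, v, max u v w} R M)
    (hM : IsMittagLeffler.{u, v, max u v w} R M) : IsStable Rᵐᵒᵖ M := by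
  classical
  intro F _ _ _ _ f
  let b := Module.Free.chooseBasis Rᵐᵒᵖ F
  let ι := Module.Free.ChooseBasisIndex Rᵐᵒᵖ F
  set L₀ := sInf {L : Submodule R (ι → R) | tupleTensor (fun j => f (b j)) L = 0}
  have hmin : ∀ L : Submodule R (ι → R), tupleTensor (fun j => f (b j)) L = 0 → L₀ ≤ L :=
    fun L hL => sInf_le hL
  have hzero : Tensor.map M L₀.mkQ
      (∑ j, tmul R (f (b j)) (Pi.single j 1 : ι → R)) = 0 := by
    rw [map_sum]
    exact tupleTensor_sInf hF hM _
  obtain ⟨n, y, a, ha, hsum⟩ := Tensor.exists_of_map_eq_zero L₀.mkQ_surjective hzero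
  replace ha : ∀ k, a k ∈ L₀ := fun k => (Submodule.Quotient.mk_eq_zero L₀).1 (ha k)
  let ev (j : ι) : Tensor R M (ι → R) →+ M := Tensor.lift
    (AddMonoidHom.mk' (fun m => AddMonoidHom.mk' (fun q => op (q j) • m)
      fun q q' => by simp [add_smul]) fun m m' => by ext q; simp)
    fun r m q => by simp [mul_smul]
  have hev : ∀ j m q, ev j (tmul R m q) = op (q j) • m := fun j m q => Tensor.lift_tmul _ _ m q
  have hfb : ∀ j, f (b j) = ∑ k, op (a k j) • y k := by
    intro j
    have := congrArg (ev j) hsum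
    simpa [map_sum, hev, Pi.single_apply, apply_ite op, ite_smul] using this
  let u : F →ₗ[Rᵐᵒᵖ] (Fin n → Rᵐᵒᵖ) := b.constr ℕ fun j k => op (a k j)
  have hu : ∀ j k, u (b j) k = op (a k j) := fun j k => by
    simp only [u, Module.Basis.constr_basis]
  refine ⟨n, u, Fintype.linearCombination Rᵐᵒᵖ y, ?_, ?_, ?_⟩
  · refine b.ext fun j => ?_
    simp [Fintype.linearCombination_apply, hu, hfb]
  · intro c hc
    rw [LinearMap.mem_ker] at hc ⊢
    -- A relation `f c = 0` makes the tensor vanish in `M ⊗ R` along `ψ`, hence, by flatness, in `M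
    -- ⊗ (R^ι / ker ψ)`. So `L₀ ≤ ker ψ`, and `ψ (a k) = 0` says that coordinate `k` of `u c` is
    -- zero.
    let ψ : (ι → R) →ₗ[R] R := Fintype.linearCombination R fun j => unop (b.repr c j)
    have hL : tupleTensor (fun j => f (b j)) (ker ψ) = 0 := by
      apply hF.map_injective ((ker ψ).liftQ ψ le_rfl)
        (by rw [← LinearMap.ker_eq_bot, Submodule.ker_liftQ_eq_bot _ _ _ le_rfl])
      rw [map_tupleTensor, map_zero]
      have : ∀ j, tmul R (f (b j)) (((ker ψ).liftQ ψ le_rfl) ((ker ψ).mkQ (Pi.single j 1))) =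
          tmul R (b.repr c j • f (b j)) (1 : R) := fun j => by
        rw [← op_unop (b.repr c j), smul_tmul]
        simp [ψ]
      rw [Finset.sum_congr rfl fun j _ => this j, ← sum_tmul]
      rw [← map_eq_sum_repr b f c, hc, zero_tmul]
    ext k
    have hk : ψ (a k) = 0 := hmin _ hL (ha k)
    rw [map_eq_sum_repr b u c]
    apply unop_injective
    simpa [ψ, Fintype.linearCombination_apply, hu, Finset.sum_apply] using hk
  · intro H _ _ _ _ u' g' _ hg
    -- `L` collects the tuples obtained from `u'` by functionals on `H`. Expanding `f = g' ∘ u'` in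
    -- a basis of `H` puts the tensor in terms of such tuples, so `L₀ ≤ L`, and the functionals
    -- giving the `a k` assemble into the map `H → R^n`.
    let L : Submodule R (ι → R) :=
      { carrier := {x | ∃ φ : H →ₗ[Rᵐᵒᵖ] Rᵐᵒᵖ, ∀ j, op (x j) = φ (u' (b j))}
        add_mem' := by
          rintro x x' ⟨φ, h⟩ ⟨φ', h'⟩
          exact ⟨φ + φ', fun j => by simp [h, h']⟩
        zero_mem' := ⟨0, fun j => by simp⟩
        smul_mem' := by
          rintro r x ⟨φ, h⟩
          exact ⟨toSpanSingleton Rᵐᵒᵖ Rᵐᵒᵖ (op r) ∘ₗ φ, fun j => by simp [h]⟩ }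
    let d := Module.Free.chooseBasis Rᵐᵒᵖ H
    have hL : tupleTensor (fun j => f (b j)) L = 0 := by
      have h1 : ∀ j, f (b j) = ∑ k, d.repr (u' (b j)) k • g' (d k) := fun j => by
        rw [← hg, LinearMap.comp_apply, ← map_eq_sum_repr d g']
      have h2 : ∀ j, tmul R (f (b j)) (L.mkQ (Pi.single j 1)) =
          ∑ k, tmul R (g' (d k)) (L.mkQ (unop (d.repr (u' (b j)) k) • Pi.single j 1)) := by
        intro j
        rw [h1, sum_tmul]
        refine Finset.sum_congr rfl fun k _ => ?_
        rw [map_smul, ← smul_tmul, op_unop]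
      rw [tupleTensor, Finset.sum_congr rfl fun j _ => h2 j, Finset.sum_comm]
      refine Finset.sum_eq_zero fun k _ => ?_
      rw [← tmul_sum, ← map_sum]
      have : ∑ j, unop (d.repr (u' (b j)) k) • (Pi.single j 1 : ι → R) ∈ L :=
        ⟨d.coord k, fun j => by
          simp [Finset.sum_apply, Pi.single_apply]⟩
      rw [Submodule.mkQ_apply, (Submodule.Quotient.mk_eq_zero L).2 this, tmul_zero]
    choose φ hφ using fun k => hmin L hL (ha k)
    refine ⟨LinearMap.pi φ, b.ext fun j => ?_⟩
    ext k
    rw [hu, hφ]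
    rfl

end FlatMittagLeffler

end MLModule

theorem theorem2 (R : Type u) [Ring R] (M : Type v) [AddCommGroup M] [Module Rᵐᵒᵖ M] :
    (MLModule.IsKappaProjective Rᵐᵒᵖ M (Cardinal.aleph 1) ↔
      MLModule.IsFlat.{u, v, max u v w} R M ∧ MLModule.IsMittagLeffler.{u, v, max u v w} R M) ∧
    ∀ κ : Cardinal.{v}, κ.IsRegular → Cardinal.aleph0 < κ →
      MLModule.IsKappaProjective Rᵐᵒᵖ M κ →
        MLModule.IsFlat.{u, v, max u v w} R M ∧ MLModule.IsMittagLeffler.{u, v, max u v w} R M := by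
  have main : ∀ κ : Cardinal.{v}, Cardinal.aleph0 < κ → MLModule.IsKappaProjective Rᵐᵒᵖ M κ →
      MLModule.IsFlat.{u, v, max u v w} R M ∧ MLModule.IsMittagLeffler.{u, v, max u v w} R M :=
    fun κ hκ h => ⟨(h.isStable hκ).isFlat, (h.isStable hκ).isMittagLeffler⟩
  refine ⟨⟨main _ Cardinal.aleph0_lt_aleph_one, fun h => ?_⟩, fun κ _ => main κ⟩
  exact (MLModule.isStable_of_isFlat_of_isMittagLeffler.{u, v, w} h.1
    h.2).isKappaProjective_aleph_one
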